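/- Let $\mathcal M$ be a compact connected smooth manifold with a Riemannian metric and let $f$ be a $C^1$ diffeomorphism of $\mathcal M$ that is partially hyperbolic: there are a $Df$-invariant splitting $T\mathcal M=E^s\oplus E^c\oplus E^u$ with $E^s,E^u$ nonzero and continuous positive functions $\nu<1$, $\hat\nu<1$, $\gamma$, $\hat\gamma$ on $\mathcal M$ such that, for all $x\in\mathcal M$ and all unit vectors $v^s\in E^s(x)$, $v^c\in E^c(x)$, $v^u\in E^u(x)$, $$\|Df_x v^s\|<\nu(x)<\gamma(x)<\|Df_x v^c\|<\hat\gamma(x)^{-1}<\hat\nu(x)^{-1}<\|Df_x v^u\|.$$ ($E^c$ may be zero; the conditions on $v^c$ are then void.) For $*\in\{s,u\}$ the leaf $W^*(x)$ is the set of endpoints of $C^1$ curves tangent to $E^*$ starting at $x$, and the distance along the leaf is the infimum of the lengths of such curves. Let $V$ be a real or complex Banach space, let $GL(V)$ be the group of invertible continuous linear operators of $V$ with the metric $d(S,T)=\|S-T\|+\|S^{-1}-T^{-1}\|$, and let $\beta>0$. A function $A:\mathcal M\to GL(V)$ is $\beta$-Hölder if $d(A(x),A(y))\le K\,\mathrm{dist}(x,y)^\beta$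 for some $K$ and all $x,y$. It generates the cocycle $\mathcal A^n_x=A(f^{n-1}x)\circ\cdots\circ A(x)$, $\mathcal A^{-n}_x=(\mathcal A^n_{f^{-n}x})^{-1}$ for $n\ge 0$. This cocycle is $\beta$ fiber bunched if $A$ is $\beta$-Hölder and, for all $x$, $$\|A(x)\|\,\|A(x)^{-1}\|\,\nu(x)^\beta<1\quad\text{and}\quad \|A(x)\|\,\|A(x)^{-1}\|\,\hat\nu(x)^\beta<1.$$ The standard stable holonomy of $\mathcal A$ is the family $H^{\mathcal A,s}_{x,y}\in GL(V)$, $x\in\mathcal M$, $y\in W^s(x)$, such that $$H^{\mathcal A,s}_{x,y}=\lim_{n\to\infty}(\mathcal A^n_y)^{-1}\circ\mathcal A^n_x ,$$ provided that the limits exist and that the family is continuous in $(x,y)$ on each set of pairs at leaf distance less than $R$, $R>0$, and satisfies $H_{x,x}=\mathrm{Id}$, $H_{y,z}\circ H_{x,y}=H_{x,z}$ and $H_{x,y}=(\mathcal A^n_y)^{-1}\circ H_{f^nx,f^ny}\circ\mathcal A^n_x$ for $n\ge0$. The standard unstable holonomy $H^{\mathcal A,u}$ is defined in the same way with $W^u$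 in place of $W^s$ and with $-n$ in place of $n$ in $f^n$, $\mathcal A^n$. **Proposition.** Let the cocycles $\mathcal A$ and $\mathcal B$ over $f$ generated by $A$ and $B$ be $\beta$ fiber bunched. Then $\mathcal A$ and $\mathcal B$ have standard stable and unstable holonomies, and every $\beta$-Hölder conjugacy between them, i.e. every $\beta$-Hölder $C:\mathcal M\to GL(V)$ with $A(x)=C(fx)\circ B(x)\circ C(x)^{-1}$ for all $x$, intertwines them: for $*\in\{s,u\}$, $$H^{\mathcal A,*}_{x,y}=C(y)\circ H^{\mathcal B,*}_{x,y}\circ C(x)^{-1}\qquad\text{for all }x\in\mathcal M,\ y\in W^*(x).$$ -/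

import Mathlib

open Set Filter Topology Manifold Bundle
open scoped ContDiff ENNReal

noncomputable section

namespace PHCocycle

/-! ### Group-valued cocycles over an invertible map -/

section Cocycle

variable {M G : Type*} [Group G]

/-- `A (f^(n-1) x) * ⋯ * A (f x) * A x`, the cocycle at a nonnegative time. -/
def forward (f : Equiv.Perm M) (A : M → G) (x : M) : ℕ → G
  | 0 => 1
  | n + 1 => A ((f ^ n) x) * forward f A x n

/-- The cocycle over `f` generated by `A`, for all integer times; for a negative time it is given by
`𝒜(x, -n) = 𝒜(f^(-n) x, n)⁻¹`. -/
def cocycle (f : Equiv.Perm M) (A : M → G) (x : M) : ℤ → G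
  | .ofNat n => forward f A x n
  | .negSucc n => (forward f A ((f ^ (Int.negSucc n)) x) (n + 1))⁻¹

/-- `C` is a conjugacy between the cocycles generated by `A` and `B`. -/
def IsConjugacy (f : Equiv.Perm M) (A B C : M → G) : Prop :=
  ∀ x, A x = C (f x) * B x * (C x)⁻¹

/-- `C` intertwines the families `HA` and `HB` of maps between the fibers over points of the same
leaf; `W x` is the leaf through `x`. -/
def Intertwines (W : M → Set M) (C : M → G) (HA HB : M → M → G) : Prop :=
  ∀ x, ∀ y ∈ W x, HA x y = C y * HB x y * (C x)⁻¹

end Cocycle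

/-! ### The group of invertible continuous linear operators of a normed space -/

section LinearGroup

variable {M 𝕜 V : Type*} [PseudoMetricSpace M] [RCLike 𝕜] [NormedAddCommGroup V] [NormedSpace 𝕜 V]

/-- The metric `‖A - B‖ + ‖A⁻¹ - B⁻¹‖` on `GL(V)`; it induces the topology of the group of units. -/
def distGL (A B : (V →L[𝕜] V)ˣ) : ℝ :=
  ‖(A : V →L[𝕜] V) - (B : V →L[𝕜] V)‖ +
    ‖((A⁻¹ : (V →L[𝕜] V)ˣ) : V →L[𝕜] V) - ((B⁻¹ : (V →L[𝕜] V)ˣ) : V →L[𝕜] V)‖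

/-- Hölder continuity with exponent `β` of a `GL(V)`-valued function. -/
def IsHolder (β : ℝ) (A : M → (V →L[𝕜] V)ˣ) : Prop :=
  ∃ K : ℝ, ∀ x y, distGL (A x) (A y) ≤ K * dist x y ^ β

end LinearGroup

/-! ### Partially hyperbolic diffeomorphisms and their foliations -/

section Hyperbolic

variable {d : ℕ} {M : Type*} [MetricSpace M] [ChartedSpace (EuclideanSpace ℝ (Fin d)) M]

/-- `γ`, restricted to `[0,1]`, is a `C¹` curve from `x` to `y` tangent to the field `E` of
subspaces. -/
structure IsTangentCurve (E : ∀ x : M, Submodule ℝ (TangentSpace (𝓡 d) x)) (x y : M)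
    (γ : ℝ → M) : Prop where
  contMDiffOn : ContMDiffOn 𝓘(ℝ, ℝ) (𝓡 d) 1 γ (Icc 0 1)
  source : γ 0 = x
  target : γ 1 = y
  tangent : ∀ t ∈ Icc (0 : ℝ) 1, mfderivWithin 𝓘(ℝ, ℝ) (𝓡 d) γ (Icc 0 1) t (1 : ℝ) ∈ E (γ t)

/-- The leaf through `x` of the foliation tangent to `E`: the points which are joined to `x` by a
`C¹` curve tangent to `E`. -/
def leaf (E : ∀ x : M, Submodule ℝ (TangentSpace (𝓡 d) x)) (x : M) : Set M :=
  {y | ∃ γ : ℝ → M, IsTangentCurve E x y γ}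

/-- The distance along the leaves: the infimum of the lengths of the `C¹` curves tangent to `E` from
`x` to `y` (infinite if `y` is not in the leaf of `x`). -/
def leafEDist [RiemannianBundle (fun x : M ↦ TangentSpace (𝓡 d) x)]
    (E : ∀ x : M, Submodule ℝ (TangentSpace (𝓡 d) x)) (x y : M) : ℝ≥0∞ :=
  ⨅ (γ : ℝ → M) (_ : IsTangentCurve E x y γ), pathELength (𝓡 d) γ 0 1

/-- Partial hyperbolicity of `f` with respect to the given Riemannian metric, together with the
splitting and with a choice of the functions controlling the rates. The stable and the unstable
bundle are nonzero; the center bundle may be zero (Anosov diffeomorphisms). -/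
structure PartiallyHyperbolic [RiemannianBundle (fun x : M ↦ TangentSpace (𝓡 d) x)]
    (f : M ≃ₘ^1⟮𝓡 d, 𝓡 d⟯ M) where
  /-- the stable bundle -/
  Es : ∀ x : M, Submodule ℝ (TangentSpace (𝓡 d) x)
  /-- the center bundle -/
  Ec : ∀ x : M, Submodule ℝ (TangentSpace (𝓡 d) x)
  /-- the unstable bundle -/
  Eu : ∀ x : M, Submodule ℝ (TangentSpace (𝓡 d) x)
  splitting : ∀ x, DirectSum.IsInternal
    (![Es x, Ec x, Eu x] : Fin 3 → Submodule ℝ (TangentSpace (𝓡 d) x))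
  Es_ne_bot : ∀ x, Es x ≠ ⊥
  Eu_ne_bot : ∀ x, Eu x ≠ ⊥
  map_Es : ∀ x, (Es x).map (mfderiv (𝓡 d) (𝓡 d) f x).toLinearMap = Es (f x)
  map_Ec : ∀ x, (Ec x).map (mfderiv (𝓡 d) (𝓡 d) f x).toLinearMap = Ec (f x)
  map_Eu : ∀ x, (Eu x).map (mfderiv (𝓡 d) (𝓡 d) f x).toLinearMap = Eu (f x)
  /-- the function `ν` -/
  nu : M → ℝ
  /-- the function `ν̂` -/
  nuHat : M → ℝ
  /-- the function `γ` -/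
  gam : M → ℝ
  /-- the function `γ̂` -/
  gamHat : M → ℝ
  continuous_nu : Continuous nu
  continuous_nuHat : Continuous nuHat
  continuous_gam : Continuous gam
  continuous_gamHat : Continuous gamHat
  nu_pos : ∀ x, 0 < nu x
  nuHat_pos : ∀ x, 0 < nuHat x
  gam_pos : ∀ x, 0 < gam x
  gamHat_pos : ∀ x, 0 < gamHat x
  nu_lt_one : ∀ x, nu x < 1
  nuHat_lt_one : ∀ x, nuHat x < 1
  stable_lt : ∀ x, ∀ v ∈ Es x, ‖v‖ = 1 → ‖mfderiv (𝓡 d) (𝓡 d) f x v‖ < nu x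
  nu_lt_gam : ∀ x, nu x < gam x
  lt_center : ∀ x, ∀ v ∈ Ec x, ‖v‖ = 1 → gam x < ‖mfderiv (𝓡 d) (𝓡 d) f x v‖
  center_lt : ∀ x, ∀ v ∈ Ec x, ‖v‖ = 1 → ‖mfderiv (𝓡 d) (𝓡 d) f x v‖ < (gamHat x)⁻¹
  gamHat_inv_lt : ∀ x, (gamHat x)⁻¹ < (nuHat x)⁻¹
  lt_unstable : ∀ x, ∀ v ∈ Eu x, ‖v‖ = 1 → (nuHat x)⁻¹ < ‖mfderiv (𝓡 d) (𝓡 d) f x v‖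

variable [RiemannianBundle (fun x : M ↦ TangentSpace (𝓡 d) x)] {f : M ≃ₘ^1⟮𝓡 d, 𝓡 d⟯ M}

/-- The leaf `W^s(x)` of the stable foliation. -/
def PartiallyHyperbolic.Ws (P : PartiallyHyperbolic f) (x : M) : Set M := leaf P.Es x

/-- The leaf `W^u(x)` of the unstable foliation. -/
def PartiallyHyperbolic.Wu (P : PartiallyHyperbolic f) (x : M) : Set M := leaf P.Eu x

variable {𝕜 V : Type*} [RCLike 𝕜] [NormedAddCommGroup V] [NormedSpace 𝕜 V]

/-- The cocycle generated by `A` is `β` fiber bunched. -/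
def IsFiberBunched (P : PartiallyHyperbolic f) (β : ℝ) (A : M → (V →L[𝕜] V)ˣ) : Prop :=
  IsHolder β A ∧ ∀ x,
    ‖(A x : V →L[𝕜] V)‖ * ‖(((A x)⁻¹ : (V →L[𝕜] V)ˣ) : V →L[𝕜] V)‖ * P.nu x ^ β < 1 ∧
    ‖(A x : V →L[𝕜] V)‖ * ‖(((A x)⁻¹ : (V →L[𝕜] V)ˣ) : V →L[𝕜] V)‖ * P.nuHat x ^ β < 1

/-- `H` is the standard stable holonomy of the cocycle generated by `A`. Only the values `H x y` with
`y ∈ W^s(x)` matter. Continuity is meant on each set of pairs of points of the same leaf whose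
distance along the leaf is bounded. -/
structure IsStandardStableHolonomy (P : PartiallyHyperbolic f) (A : M → (V →L[𝕜] V)ˣ)
    (H : M → M → (V →L[𝕜] V)ˣ) : Prop where
  continuousOn : ∀ R : ℝ, 0 < R →
    ContinuousOn (fun p : M × M ↦ H p.1 p.2) {p | leafEDist P.Es p.1 p.2 < ENNReal.ofReal R}
  self : ∀ x, H x x = 1
  comp : ∀ x, ∀ y ∈ P.Ws x, ∀ z ∈ P.Ws y, H y z * H x y = H x z
  equivariant : ∀ x, ∀ y ∈ P.Ws x, ∀ n : ℕ,
    H x y = (cocycle f.toEquiv A y n)⁻¹ *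
      H (((f.toEquiv : Equiv.Perm M) ^ n) x) (((f.toEquiv : Equiv.Perm M) ^ n) y) *
        cocycle f.toEquiv A x n
  standard : ∀ x, ∀ y ∈ P.Ws x,
    Tendsto (fun n : ℕ ↦ (cocycle f.toEquiv A y n)⁻¹ * cocycle f.toEquiv A x n) atTop (𝓝 (H x y))

/-- `H` is the standard unstable holonomy of the cocycle generated by `A`. Only the values `H x y`
with `y ∈ W^u(x)` matter. -/
structure IsStandardUnstableHolonomy (P : PartiallyHyperbolic f) (A : M → (V →L[𝕜] V)ˣ)
    (H : M → M → (V →L[𝕜] V)ˣ) : Prop where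
  continuousOn : ∀ R : ℝ, 0 < R →
    ContinuousOn (fun p : M × M ↦ H p.1 p.2) {p | leafEDist P.Eu p.1 p.2 < ENNReal.ofReal R}
  self : ∀ x, H x x = 1
  comp : ∀ x, ∀ y ∈ P.Wu x, ∀ z ∈ P.Wu y, H y z * H x y = H x z
  equivariant : ∀ x, ∀ y ∈ P.Wu x, ∀ n : ℕ,
    H x y = (cocycle f.toEquiv A y (-(n : ℤ)))⁻¹ *
      H (((f.toEquiv : Equiv.Perm M) ^ (-(n : ℤ))) x)
        (((f.toEquiv : Equiv.Perm M) ^ (-(n : ℤ))) y) *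
        cocycle f.toEquiv A x (-(n : ℤ))
  standard : ∀ x, ∀ y ∈ P.Wu x,
    Tendsto (fun n : ℕ ↦ (cocycle f.toEquiv A y (-(n : ℤ)))⁻¹ * cocycle f.toEquiv A x (-(n : ℤ)))
      atTop (𝓝 (H x y))

end Hyperbolic

end PHCocycle

end

namespace PHCocycle

/-! ### Cocycle algebra, time reversal and conjugacies -/

section Algebra

variable {M G : Type*} [Group G] (f : Equiv.Perm M) (A : M → G)

/-! Everything rests on one estimate. For `y` on the stable leaf of `x`, let xₙ, yₙ be the iterates
and ℓₙ the length of the fⁿ-image of a tangent curve joining `x` to `y`. At each step qₙ =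
‖(𝒜ⁿ_y)⁻¹‖ ‖𝒜ⁿ_x‖ ℓₙ^β is multiplied by at most ‖A(yₙ)⁻¹‖ ‖A(xₙ)‖ ν(zₙ)^β, with zₙ on the image
curve. The three points merge as ℓₙ → 0, so by fiber bunching and compactness this factor is
eventually below a constant less than 1, and qₙ decays geometrically
(`IsBunched.exists_geometric_bound`).

Consecutive operators (𝒜ⁿ_y)⁻¹𝒜ⁿ_x differ by (𝒜ⁿ_y)⁻¹(A(yₙ)⁻¹A(xₙ) − Id)𝒜ⁿ_x, which is O(qₙ) by the
Hölder condition. Hence they converge, uniformly at bounded leaf distance, which gives continuity;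
the algebraic identities pass to the limit.

For a conjugacy, (𝒜ⁿ_y)⁻¹𝒜ⁿ_x = C(y)(ℬⁿ_y)⁻¹C(yₙ)⁻¹C(xₙ)ℬⁿ_x C(x)⁻¹, and replacing C(yₙ)⁻¹C(xₙ) by
Id again costs O(qₙ), now with qₙ formed from ℬ (`IsBunched.limit_intertwines`).

The unstable case is the same argument for f⁻¹, `reverse f A` and the rate ν̂ ∘ f⁻¹. -/

theorem forward_add (x : M) (m n : ℕ) :
    forward f A x (m + n) = forward f A ((f ^ n) x) m * forward f A x n := by
  induction m with
  | zero => simp [forward]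
  | succ m ih =>
    rw [Nat.add_right_comm, forward, ih, forward, pow_add, Equiv.Perm.mul_apply, mul_assoc]

theorem forward_succ' (x : M) (n : ℕ) :
    forward f A x (n + 1) = forward f A (f x) n * A x := by
  simpa [forward] using forward_add f A x n 1

/-- The generator over `f⁻¹` of the time-reversed cocycle. -/
def reverse (z : M) : G := (A (f⁻¹ z))⁻¹

/-- Turns negative times into positive times over f⁻¹, so that unstable holonomies become stable
ones. -/
theorem cocycle_neg_natCast (x : M) (n : ℕ) :
    cocycle f A x (-(n : ℤ)) = forward f⁻¹ (reverse f A) x n := by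
  have h : ∀ n : ℕ, forward f⁻¹ (reverse f A) x n = (forward f A ((f⁻¹ ^ n) x) n)⁻¹ := by
    intro n
    induction n with
    | zero => simp [forward]
    | succ n ih =>
      have e : f ((f⁻¹ ^ (n + 1)) x) = (f⁻¹ ^ n) x := by
        rw [pow_succ', Equiv.Perm.mul_apply]
        exact f.apply_symm_apply _
      rw [forward, ih, forward_succ', e, mul_inv_rev, reverse, pow_succ', Equiv.Perm.mul_apply]
  rw [h]
  cases n with
  | zero => exact inv_one.symm
  | succ n =>
    have e : (-((n + 1 : ℕ) : ℤ)) = Int.negSucc n := rfl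
    rw [e, cocycle, inv_pow, zpow_negSucc]

/-- The operator `(𝒜ⁿ_y)⁻¹ 𝒜ⁿ_x`. -/
def transition (n : ℕ) (x y : M) : G := (forward f A y n)⁻¹ * forward f A x n

theorem transition_self (n : ℕ) (x : M) : transition f A n x x = 1 := by
  simp [transition]

theorem transition_comp (n : ℕ) (x y z : M) :
    transition f A n y z * transition f A n x y = transition f A n x z := by
  simp [transition, mul_assoc]

theorem transition_add (m n : ℕ) (x y : M) :
    transition f A (m + n) x y =
      (forward f A y n)⁻¹ * transition f A m ((f ^ n) x) ((f ^ n) y) * forward f A x n := by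
  simp [transition, forward_add, mul_assoc]

variable {f A}

theorem IsConjugacy.forward {B C : M → G} (h : IsConjugacy f A B C) (x : M) (n : ℕ) :
    forward f A x n = C ((f ^ n) x) * PHCocycle.forward f B x n * (C x)⁻¹ := by
  induction n with
  | zero => simp [PHCocycle.forward]
  | succ n ih =>
    rw [PHCocycle.forward, ih, h, PHCocycle.forward, pow_succ', Equiv.Perm.mul_apply]
    group

theorem IsConjugacy.reverse {B C : M → G} (h : IsConjugacy f A B C) :
    IsConjugacy f⁻¹ (reverse f A) (reverse f B) C := by
  intro x
  have h := h (f⁻¹ x)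
  rw [show f (f⁻¹ x) = x from f.apply_symm_apply x] at h
  rw [PHCocycle.reverse, h, PHCocycle.reverse]
  group

/-- Isolates the near-identity factor C(yₙ)⁻¹C(xₙ); without it the middle term would be the
transition of `B`. -/
theorem IsConjugacy.transition {B C : M → G} (h : IsConjugacy f A B C) (n : ℕ) (x y : M) :
    transition f A n x y = C y * ((PHCocycle.forward f B y n)⁻¹ *
      ((C ((f ^ n) y))⁻¹ * C ((f ^ n) x)) * PHCocycle.forward f B x n) * (C x)⁻¹ := by
  rw [PHCocycle.transition, h.forward, h.forward]
  group

end Algebra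

/-! ### Geometric decay from an eventual contraction -/

section Sequences

/-- Each of the first `N` steps loses at most a factor `D / θ` against the rate `θ`, and later steps
lose nothing. -/
theorem le_geometric_of_eventually {q : ℕ → ℝ} {Q D θ : ℝ} {N : ℕ} (hq : ∀ n, 0 ≤ q n)
    (h0 : q 0 ≤ Q) (hθ : 0 < θ) (hD : θ ≤ D) (h1 : ∀ n, q (n + 1) ≤ D * q n)
    (h2 : ∀ n, N ≤ n → q (n + 1) ≤ θ * q n) (n : ℕ) : q n ≤ Q * (D / θ) ^ N * θ ^ n := by
  have hQ : 0 ≤ Q := (hq 0).trans h0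
  have hD0 : 0 < D := hθ.trans_le hD
  have key : q n ≤ Q * (D / θ) ^ (min n N) * θ ^ n := by
    induction n with
    | zero => simpa using h0
    | succ n ih =>
      rcases lt_or_ge n N with hn | hn
      · rw [min_eq_left hn.le] at ih
        rw [min_eq_left (Nat.succ_le_of_lt hn)]
        refine (h1 n).trans ((mul_le_mul_of_nonneg_left ih hD0.le).trans_eq ?_)
        rw [Nat.succ_eq_add_one, pow_succ, pow_succ]
        field_simp
      · rw [min_eq_right hn] at ih
        rw [min_eq_right (hn.trans n.le_succ)]
        refine (h2 n hn).trans ((mul_le_mul_of_nonneg_left ih hθ.le).trans_eq ?_)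
        ring
  refine key.trans ?_
  gcongr
  · exact (one_le_div hθ).2 hD
  · exact min_le_right _ _

end Sequences

/-! ### Pairs of contracting orbits -/

section Shrinking

variable {M : Type*} [PseudoMetricSpace M]

/-- The numbers `ℓ n` bound the distances of the iterates of `x` and `y`, and decrease at a rate
given by `ν` near these iterates. -/
structure IsShrinking (f : Equiv.Perm M) (ν : M → ℝ) (x y : M) (ℓ : ℕ → ℝ) : Prop where
  dist_le : ∀ n, dist ((f ^ n) x) ((f ^ n) y) ≤ ℓ n
  step : ∀ n, ∃ z, dist ((f ^ n) x) z ≤ ℓ n ∧ dist ((f ^ n) y) z ≤ ℓ n ∧ ℓ (n + 1) ≤ ν z * ℓ n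

namespace IsShrinking

variable {f : Equiv.Perm M} {ν : M → ℝ} {x y : M} {ℓ : ℕ → ℝ}

theorem symm (h : IsShrinking f ν x y ℓ) : IsShrinking f ν y x ℓ where
  dist_le n := by simpa only [dist_comm] using h.dist_le n
  step n := by
    obtain ⟨z, h1, h2, h3⟩ := h.step n
    exact ⟨z, h2, h1, h3⟩

theorem nonneg (h : IsShrinking f ν x y ℓ) (n : ℕ) : 0 ≤ ℓ n := dist_nonneg.trans (h.dist_le n)

theorem succ_le (h : IsShrinking f ν x y ℓ) {s : ℝ} (hs : ∀ z, ν z ≤ s) (n : ℕ) :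
    ℓ (n + 1) ≤ s * ℓ n := by
  obtain ⟨z, -, -, h3⟩ := h.step n
  exact h3.trans (mul_le_mul_of_nonneg_right (hs z) (h.nonneg n))

theorem le_pow (h : IsShrinking f ν x y ℓ) {s : ℝ} (hs0 : 0 ≤ s) (hs : ∀ z, ν z ≤ s) (n : ℕ) :
    ℓ n ≤ s ^ n * ℓ 0 := by
  induction n with
  | zero => simp
  | succ n ih =>
    refine (h.succ_le hs n).trans ((mul_le_mul_of_nonneg_left ih hs0).trans_eq ?_)
    ring

end IsShrinking

end Shrinking

/-! ### Bunching, convergence of transitions and their conjugation -/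

section Convergence

variable {M R : Type*} [PseudoMetricSpace M] [NormedRing R]

/-- `A` is bunched with respect to the rate `ν`. -/
structure IsBunched (ν : M → ℝ) (β : ℝ) (A : M → Rˣ) : Prop where
  exponent_pos : 0 < β
  continuous : Continuous A
  continuous_rate : Continuous ν
  rate_pos : ∀ x, 0 < ν x
  rate_lt_one : ∀ x, ν x < 1
  lt_one : ∀ x, ‖(A x : R)‖ * ‖(((A x)⁻¹ : Rˣ) : R)‖ * ν x ^ β < 1

/-- A relative Hölder condition on `A`, measured along a step of `f`. -/
def IsRelHolder (f : Equiv.Perm M) (K β : ℝ) (A : M → Rˣ) : Prop :=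
  ∀ x y, ‖(((A y)⁻¹ * A x : Rˣ) : R) - 1‖ ≤ K * max (dist x y) (dist (f x) (f y)) ^ β

variable {f : Equiv.Perm M} {ν : M → ℝ} {β K : ℝ} {A : M → Rˣ}

/-- Serves twice: `C = A` gives the difference of consecutive transitions, and a conjugacy `C` gives
the error in the intertwining relation. -/
theorem IsBunched.norm_relHolder_le (hA : IsBunched ν β A) {C : M → Rˣ} (hC : IsRelHolder f K β C)
    (hK : 0 ≤ K) {x y : M} {ℓ : ℕ → ℝ} (h : IsShrinking f ν x y ℓ) (n : ℕ) :
    ‖(((forward f A y n)⁻¹ * ((C ((f ^ n) y))⁻¹ * C ((f ^ n) x)) * forward f A x n : Rˣ) : R) -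
      (↑(transition f A n x y) : R)‖ ≤
      K * (‖(((forward f A y n)⁻¹ : Rˣ) : R)‖ * ‖(↑(forward f A x n) : R)‖ * ℓ n ^ β) := by
  have e : (((forward f A y n)⁻¹ * ((C ((f ^ n) y))⁻¹ * C ((f ^ n) x)) * forward f A x n : Rˣ) : R) -
      (↑(transition f A n x y) : R) = (((forward f A y n)⁻¹ : Rˣ) : R) *
        ((((C ((f ^ n) y))⁻¹ * C ((f ^ n) x) : Rˣ) : R) - 1) * (↑(forward f A x n) : R) := by
    simp only [transition, Units.val_mul]
    noncomm_ring
  -- The distance one step later is at most `ℓ (n + 1)`, hence at most `ℓ n` because the rate is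
  -- below 1.
  have hm : max (dist ((f ^ n) x) ((f ^ n) y)) (dist (f ((f ^ n) x)) (f ((f ^ n) y))) ≤ ℓ n := by
    refine max_le (h.dist_le n) ?_
    have h1 := h.dist_le (n + 1)
    rw [pow_succ', Equiv.Perm.mul_apply, Equiv.Perm.mul_apply] at h1
    exact h1.trans ((h.succ_le (fun z ↦ (hA.rate_lt_one z).le) n).trans_eq (one_mul _))
  have hH := (hC ((f ^ n) x) ((f ^ n) y)).trans (mul_le_mul_of_nonneg_left
    (Real.rpow_le_rpow (le_max_of_le_left dist_nonneg) hm hA.exponent_pos.le) hK)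
  rw [e]
  calc _ ≤ _ := norm_mul_le _ _
    _ ≤ ‖(((forward f A y n)⁻¹ : Rˣ) : R)‖ * (K * ℓ n ^ β) * ‖(↑(forward f A x n) : R)‖ := by
      gcongr
      exact (norm_mul_le _ _).trans (by gcongr)
    _ = _ := by ring

theorem continuous_forward (hf : Continuous f) (hA : Continuous A) (n : ℕ) :
    Continuous fun x ↦ forward f A x n := by
  induction n with
  | zero => exact continuous_const
  | succ n ih =>
    simp only [forward]
    refine (hA.comp ?_).mul ih
    rw [Equiv.Perm.coe_pow]
    exact hf.iterate n

theorem continuous_transition (hf : Continuous f) (hA : Continuous A) (n : ℕ) :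
    Continuous fun p : M × M ↦ transition f A n p.1 p.2 :=
  ((continuous_forward hf hA n).comp continuous_snd).inv.mul
    ((continuous_forward hf hA n).comp continuous_fst)

variable [CompactSpace M]

theorem exists_forall_le_lt_one [Nonempty M] {g : M → ℝ} (hg : Continuous g)
    (h : ∀ x, g x < 1) : ∃ s < 1, ∀ x, g x ≤ s := by
  obtain ⟨x, -, hx⟩ := isCompact_univ.exists_isMaxOn univ_nonempty hg.continuousOn
  exact ⟨g x, h x, fun y ↦ hx (mem_univ y)⟩

theorem exists_forall_le {X : Type*} [TopologicalSpace X] [CompactSpace X] {g : X → ℝ}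
    (hg : Continuous g) : ∃ s, ∀ x, g x ≤ s := by
  obtain ⟨s, hs⟩ := (isCompact_range hg).bddAbove
  exact ⟨s, fun x ↦ hs (mem_range_self x)⟩

-- The constants depend on `r` but not on the pair of points; this uniformity yields continuity of
-- the holonomy.
variable (f) in
theorem IsBunched.exists_geometric_bound (hA : IsBunched ν β A) (r : ℝ) :
    ∃ C θ : ℝ, 0 ≤ C ∧ 0 < θ ∧ θ < 1 ∧ ∀ x y ℓ, IsShrinking f ν x y ℓ → ℓ 0 ≤ r → ∀ n,
      ‖(((forward f A y n)⁻¹ : Rˣ) : R)‖ * ‖(↑(forward f A x n) : R)‖ * ℓ n ^ β ≤ C * θ ^ n := by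
  rcases isEmpty_or_nonempty M with hM | hM
  · exact ⟨0, 1 / 2, le_rfl, by norm_num, by norm_num, fun x ↦ (hM.false x).elim⟩
  have hβ := hA.exponent_pos
  have hAc : Continuous fun x ↦ (A x : R) := Units.continuous_val.comp hA.continuous
  have hAi : Continuous fun x ↦ (((A x)⁻¹ : Rˣ) : R) :=
    Units.continuous_val.comp hA.continuous.inv
  have hνβ : Continuous fun x ↦ ν x ^ β := hA.continuous_rate.rpow_const fun _ ↦ Or.inr hβ.le
  -- One step of the estimate involves three different base points, whereas bunching controls `Φ`
  -- only on the diagonal.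
  let Φ : M × M × M → ℝ := fun p ↦ ‖(((A p.1)⁻¹ : Rˣ) : R)‖ * ‖(A p.2.1 : R)‖ * ν p.2.2 ^ β
  have hΦ : Continuous Φ := ((hAi.comp continuous_fst).norm.mul
    (hAc.comp (continuous_fst.comp continuous_snd)).norm).mul
    (hνβ.comp (continuous_snd.comp continuous_snd))
  have hΦ0 : ∀ p, 0 ≤ Φ p := fun p ↦
    mul_nonneg (by positivity) (Real.rpow_nonneg (hA.rate_pos _).le _)
  obtain ⟨s, hs1, hs⟩ := exists_forall_le_lt_one hA.continuous_rate hA.rate_lt_one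
  have hs0 : 0 < s := (hA.rate_pos (Classical.arbitrary M)).trans_le (hs _)
  obtain ⟨τ, hτ1, hτ⟩ := exists_forall_le_lt_one (g := fun x : M ↦ Φ (x, x, x))
    (by fun_prop) (fun x ↦ by
      simpa only [Φ, mul_comm ‖(A x : R)‖] using hA.lt_one x)
  have hτ0 : 0 ≤ τ := (hΦ0 _).trans (hτ (Classical.arbitrary M))
  -- With this margin, `Φ` stays below `(1 + τ) / 2`, the rate `θ` chosen below, within `δ` of the
  -- diagonal.
  obtain ⟨δ, hδ, hδΦ⟩ := Metric.uniformContinuous_iff.1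
    (CompactSpace.uniformContinuous_of_continuous hΦ) ((1 - τ) / 2) (by linarith)
  obtain ⟨D₀, hD₀⟩ := exists_forall_le hΦ
  set θ := (1 + τ) / 2 with hθ
  have hθ0 : 0 < θ := by linarith
  set D := max D₀ θ
  -- After `N` steps every admissible `ℓ` is below `δ`; `max r 0` allows for a negative `r`.
  obtain ⟨N, hN⟩ : ∃ N : ℕ, s ^ N * max r 0 < δ := by
    have : Tendsto (fun n : ℕ ↦ s ^ n * max r 0) atTop (𝓝 (0 * max r 0)) :=
      (tendsto_pow_atTop_nhds_zero_of_lt_one hs0.le hs1).mul_const _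
    rw [zero_mul] at this
    exact (this.eventually (gt_mem_nhds hδ)).exists
  -- The norms of `1` come from time zero; they need not equal 1, for instance when `V` is zero.
  refine ⟨‖(1 : R)‖ * ‖(1 : R)‖ * (max r 0) ^ β * (D / θ) ^ N, θ, by positivity, hθ0,
    by linarith, ?_⟩
  intro x y ℓ h hr n
  have hℓ0 := h.nonneg
  have hrec : ∀ n, ∃ z, dist ((f ^ n) x) z ≤ ℓ n ∧ dist ((f ^ n) y) z ≤ ℓ n ∧
      ‖(((forward f A y (n + 1))⁻¹ : Rˣ) : R)‖ * ‖(↑(forward f A x (n + 1)) : R)‖ *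
        ℓ (n + 1) ^ β ≤ Φ ((f ^ n) y, (f ^ n) x, z) *
      (‖(((forward f A y n)⁻¹ : Rˣ) : R)‖ * ‖(↑(forward f A x n) : R)‖ * ℓ n ^ β) := by
    intro n
    obtain ⟨z, h1, h2, h3⟩ := h.step n
    refine ⟨z, h1, h2, ?_⟩
    have e1 : ‖(((forward f A y (n + 1))⁻¹ : Rˣ) : R)‖ ≤
        ‖(((forward f A y n)⁻¹ : Rˣ) : R)‖ * ‖(((A ((f ^ n) y))⁻¹ : Rˣ) : R)‖ := by
      rw [forward, mul_inv_rev, Units.val_mul]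
      exact norm_mul_le _ _
    have e2 : ‖(↑(forward f A x (n + 1)) : R)‖ ≤ ‖(A ((f ^ n) x) : R)‖ * ‖(↑(forward f A x n) : R)‖ := by
      rw [forward, Units.val_mul]
      exact norm_mul_le _ _
    have e3 : ℓ (n + 1) ^ β ≤ ν z ^ β * ℓ n ^ β := by
      rw [← Real.mul_rpow (hA.rate_pos z).le (hℓ0 n)]
      exact Real.rpow_le_rpow (hℓ0 _) h3 hβ.le
    calc _ ≤ (‖(((forward f A y n)⁻¹ : Rˣ) : R)‖ * ‖(((A ((f ^ n) y))⁻¹ : Rˣ) : R)‖) *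
          (‖(A ((f ^ n) x) : R)‖ * ‖(↑(forward f A x n) : R)‖) * (ν z ^ β * ℓ n ^ β) := by
          have := Real.rpow_nonneg (hℓ0 (n + 1)) β
          gcongr
      _ = _ := by simp only [Φ]; ring
  have hq0 : ∀ n, 0 ≤ ‖(((forward f A y n)⁻¹ : Rˣ) : R)‖ * ‖(↑(forward f A x n) : R)‖ * ℓ n ^ β :=
    fun n ↦ mul_nonneg (by positivity) (Real.rpow_nonneg (hℓ0 n) β)
  refine le_geometric_of_eventually (D := D) (N := N) hq0 ?_ hθ0 (le_max_right _ _) ?_ ?_ n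
  · simp only [forward, inv_one, Units.val_one]
    exact mul_le_mul_of_nonneg_left (Real.rpow_le_rpow (hℓ0 0) (hr.trans (le_max_left _ _)) hβ.le)
      (by positivity)
  · intro n
    obtain ⟨z, -, -, hz⟩ := hrec n
    exact hz.trans (mul_le_mul_of_nonneg_right ((hD₀ _).trans (le_max_left _ _)) (hq0 n))
  · intro n hn
    obtain ⟨z, h1, h2, hz⟩ := hrec n
    refine hz.trans (mul_le_mul_of_nonneg_right ?_ (hq0 n))
    have hsmall : ℓ n < δ := by
      refine lt_of_le_of_lt (h.le_pow hs0.le hs n) (lt_of_le_of_lt ?_ hN)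
      exact mul_le_mul (pow_le_pow_of_le_one hs0.le hs1.le hn) (hr.trans (le_max_left _ _))
        (hℓ0 0) (by positivity)
    have hd : dist (((f ^ n) y, (f ^ n) x, z) : M × M × M) ((f ^ n) y, (f ^ n) y, (f ^ n) y) < δ := by
      simp only [Prod.dist_eq, dist_self, max_lt_iff]
      exact ⟨hδ, (h.dist_le n).trans_lt hsmall, by rw [dist_comm]; exact h2.trans_lt hsmall⟩
    have := hδΦ hd
    rw [Real.dist_eq] at this
    have := (abs_lt.1 this).2
    have := hτ ((f ^ n) y)
    linarith

theorem IsBunched.exists_transition_bound (hA : IsBunched ν β A) (hAK : IsRelHolder f K β A)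
    (hK : 0 ≤ K) (r : ℝ) :
    ∃ C θ : ℝ, 0 ≤ C ∧ 0 < θ ∧ θ < 1 ∧ ∀ x y ℓ, IsShrinking f ν x y ℓ → ℓ 0 ≤ r → ∀ n,
      dist (↑(transition f A n x y) : R) (↑(transition f A (n + 1) x y) : R) ≤ C * θ ^ n := by
  obtain ⟨C, θ, hC, hθ0, hθ1, H⟩ := hA.exists_geometric_bound f r
  refine ⟨K * C, θ, by positivity, hθ0, hθ1, fun x y ℓ h hr n ↦ ?_⟩
  have e : transition f A (n + 1) x y =
      (forward f A y n)⁻¹ * ((A ((f ^ n) y))⁻¹ * A ((f ^ n) x)) * forward f A x n := by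
    simp [transition, forward, mul_assoc]
  rw [dist_comm, dist_eq_norm, e, mul_assoc K C]
  exact (hA.norm_relHolder_le hAK hK h n).trans (mul_le_mul_of_nonneg_left (H x y ℓ h hr n) hK)

/-- The transitions from `x` to `y` and from `y` to `x` are mutually inverse and both converge in
`R`, so the limits are mutually inverse as well and convergence takes place among the units. -/
theorem IsBunched.exists_tendsto_transition [CompleteSpace R] (hA : IsBunched ν β A)
    (hAK : IsRelHolder f K β A) (hK : 0 ≤ K) {x y : M} {ℓ : ℕ → ℝ} (h : IsShrinking f ν x y ℓ) :
    ∃ H : Rˣ, Tendsto (fun n ↦ transition f A n x y) atTop (𝓝 H) := by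
  obtain ⟨C, θ, hC, hθ0, hθ1, H⟩ := hA.exists_transition_bound hAK hK (ℓ 0)
  obtain ⟨a, ha⟩ := cauchySeq_tendsto_of_complete
    (cauchySeq_of_le_geometric θ C hθ1 (H x y ℓ h le_rfl))
  obtain ⟨b, hb⟩ := cauchySeq_tendsto_of_complete
    (cauchySeq_of_le_geometric θ C hθ1 (H y x ℓ h.symm le_rfl))
  have hab : a * b = 1 := tendsto_nhds_unique (ha.mul hb) (by
    simp only [← Units.val_mul, transition_comp, transition_self, Units.val_one]
    exact tendsto_const_nhds)
  have hba : b * a = 1 := tendsto_nhds_unique (hb.mul ha) (by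
    simp only [← Units.val_mul, transition_comp, transition_self, Units.val_one]
    exact tendsto_const_nhds)
  exact ⟨⟨a, b, hab, hba⟩, Units.isOpenEmbedding_val.tendsto_nhds_iff.2 ha⟩

variable (f A) in
/-- The limit of the operators `(𝒜ⁿ_y)⁻¹ 𝒜ⁿ_x`. -/
noncomputable def limitHolonomy (x y : M) : Rˣ := limUnder atTop fun n ↦ transition f A n x y

theorem IsBunched.tendsto_transition [CompleteSpace R] (hA : IsBunched ν β A)
    (hAK : IsRelHolder f K β A) (hK : 0 ≤ K) {x y : M} {ℓ : ℕ → ℝ} (h : IsShrinking f ν x y ℓ) :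
    Tendsto (fun n ↦ transition f A n x y) atTop (𝓝 (limitHolonomy f A x y)) :=
  tendsto_nhds_limUnder (hA.exists_tendsto_transition hAK hK h)

/-- The common bound `r` on `ℓ 0` makes the convergence of the continuous transitions uniform on
`S`. -/
theorem IsBunched.continuousOn_limitHolonomy [CompleteSpace R] (hA : IsBunched ν β A)
    (hAK : IsRelHolder f K β A) (hK : 0 ≤ K) (hf : Continuous f) {r : ℝ} {S : Set (M × M)}
    (hS : ∀ p ∈ S, ∃ ℓ, IsShrinking f ν p.1 p.2 ℓ ∧ ℓ 0 ≤ r) :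
    ContinuousOn (fun p : M × M ↦ limitHolonomy f A p.1 p.2) S := by
  obtain ⟨C, θ, hC, hθ0, hθ1, H⟩ := hA.exists_transition_bound hAK hK r
  rw [Units.isOpenEmbedding_val.isInducing.continuousOn_iff]
  have hlim : TendstoUniformlyOn (fun n (p : M × M) ↦ (↑(transition f A n p.1 p.2) : R))
      (fun p ↦ (limitHolonomy f A p.1 p.2 : R)) atTop S := by
    rw [Metric.tendstoUniformlyOn_iff]
    intro ε hε
    have h0 : Tendsto (fun n : ℕ ↦ C * θ ^ n / (1 - θ)) atTop (𝓝 (C * 0 / (1 - θ))) :=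
      ((tendsto_pow_atTop_nhds_zero_of_lt_one hθ0.le hθ1).const_mul C).div_const _
    rw [mul_zero, zero_div] at h0
    filter_upwards [h0.eventually (gt_mem_nhds hε)] with n hn p hp
    obtain ⟨ℓ, h, hr⟩ := hS p hp
    rw [dist_comm]
    exact (dist_le_of_le_geometric_of_tendsto θ C hθ1 (H p.1 p.2 ℓ h hr)
      ((Units.continuous_val.tendsto _).comp (hA.tendsto_transition hAK hK h)) n).trans_lt hn
  exact hlim.continuousOn (Frequently.of_forall fun n ↦
    (Units.continuous_val.comp (continuous_transition hf hA.continuous n)).continuousOn)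

theorem IsBunched.limit_intertwines [CompleteSpace R] {B C : M → Rˣ} (hB : IsBunched ν β B)
    (hAB : IsConjugacy f A B C) (hC : IsRelHolder f K β C) (hK : 0 ≤ K) {x y : M} {ℓ : ℕ → ℝ}
    (h : IsShrinking f ν x y ℓ) {HA HB : Rˣ}
    (hHA : Tendsto (fun n ↦ transition f A n x y) atTop (𝓝 HA))
    (hHB : Tendsto (fun n ↦ transition f B n x y) atTop (𝓝 HB)) :
    HA = C y * HB * (C x)⁻¹ := by
  obtain ⟨D, θ, hD, hθ0, hθ1, H⟩ := hB.exists_geometric_bound f (ℓ 0)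
  refine tendsto_nhds_unique hHA ?_
  simp only [hAB.transition]
  refine (tendsto_const_nhds.mul ?_).mul tendsto_const_nhds
  rw [Units.isOpenEmbedding_val.tendsto_nhds_iff]
  have hHB' := (Units.continuous_val.tendsto _).comp hHB
  refine (tendsto_iff_of_dist ?_).2 hHB'
  have h0 : Tendsto (fun n : ℕ ↦ K * (D * θ ^ n)) atTop (𝓝 (K * (D * 0))) :=
    ((tendsto_pow_atTop_nhds_zero_of_lt_one hθ0.le hθ1).const_mul D).const_mul K
  rw [mul_zero, mul_zero] at h0
  refine squeeze_zero (fun _ ↦ dist_nonneg) (fun n ↦ ?_) h0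
  rw [dist_eq_norm]
  exact (hB.norm_relHolder_le hC hK h n).trans
    (mul_le_mul_of_nonneg_left (H x y ℓ h le_rfl n) hK)

end Convergence

/-! ### Lengths of tangent curves and of their images -/

section Curves

variable {d : ℕ} {M : Type*} [MetricSpace M] [ChartedSpace (EuclideanSpace ℝ (Fin d)) M]
  {E : ∀ x : M, Submodule ℝ (TangentSpace (𝓡 d) x)} {x y : M} {γ : ℝ → M}
  {g : M ≃ₘ^1⟮𝓡 d, 𝓡 d⟯ M}

theorem IsTangentCurve.mfderivWithin_comp (hγ : IsTangentCurve E x y γ) {t : ℝ}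
    (ht : t ∈ Icc (0 : ℝ) 1) :
    mfderivWithin 𝓘(ℝ, ℝ) (𝓡 d) (g ∘ γ) (Icc 0 1) t =
      (mfderiv (𝓡 d) (𝓡 d) g (γ t)).comp (mfderivWithin 𝓘(ℝ, ℝ) (𝓡 d) γ (Icc 0 1) t) := by
  refine mfderiv_comp_mfderivWithin t (g.contMDiff.mdifferentiable one_ne_zero _)
    (hγ.contMDiffOn.mdifferentiableOn one_ne_zero t ht) ?_
  rw [uniqueMDiffWithinAt_iff_uniqueDiffWithinAt]
  exact uniqueDiffOn_Icc zero_lt_one t ht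

theorem IsTangentCurve.comp (hγ : IsTangentCurve E x y γ)
    (hg : ∀ x, ∀ v ∈ E x, mfderiv (𝓡 d) (𝓡 d) g x v ∈ E (g x)) :
    IsTangentCurve E (g x) (g y) (g ∘ γ) where
  contMDiffOn := g.contMDiff.comp_contMDiffOn hγ.contMDiffOn
  source := congrArg g hγ.source
  target := congrArg g hγ.target
  tangent t ht := by
    rw [hγ.mfderivWithin_comp ht]
    exact hg _ _ (hγ.tangent t ht)

theorem IsTangentCurve.iterate (hγ : IsTangentCurve E x y γ)
    (hg : ∀ x, ∀ v ∈ E x, mfderiv (𝓡 d) (𝓡 d) g x v ∈ E (g x)) (n : ℕ) :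
    IsTangentCurve E (((g.toEquiv : Equiv.Perm M) ^ n) x) (((g.toEquiv : Equiv.Perm M) ^ n) y)
      (((g.toEquiv : Equiv.Perm M) ^ n) ∘ γ) := by
  induction n with
  | zero => exact hγ
  | succ n ih =>
    rw [pow_succ']
    exact ih.comp hg

variable [RiemannianBundle (fun x : M ↦ TangentSpace (𝓡 d) x)]

theorem IsTangentCurve.pathELength_comp_le (hγ : IsTangentCurve E x y γ) {s : ℝ}
    (hs : ∀ t ∈ Icc (0 : ℝ) 1, ∀ v ∈ E (γ t), ‖mfderiv (𝓡 d) (𝓡 d) g (γ t) v‖ ≤ s * ‖v‖) :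
    pathELength (𝓡 d) (g ∘ γ) 0 1 ≤ ENNReal.ofReal s * pathELength (𝓡 d) γ 0 1 := by
  rw [pathELength_eq_lintegral_mfderivWithin_Icc, pathELength_eq_lintegral_mfderivWithin_Icc,
    ← MeasureTheory.lintegral_const_mul' _ _ ENNReal.ofReal_ne_top]
  refine MeasureTheory.setLIntegral_mono' measurableSet_Icc fun t ht ↦ ?_
  rw [hγ.mfderivWithin_comp ht, ← ofReal_norm, ← ofReal_norm,
    ← ENNReal.ofReal_mul' (norm_nonneg _)]
  exact ENNReal.ofReal_le_ofReal (hs t ht _ (hγ.tangent t ht))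

theorem IsTangentCurve.edist_le [IsRiemannianManifold (𝓡 d) M] (hγ : IsTangentCurve E x y γ)
    {a b : ℝ} (ha : 0 ≤ a) (hab : a ≤ b) (hb : b ≤ 1) :
    edist (γ a) (γ b) ≤ pathELength (𝓡 d) γ 0 1 := by
  rw [IsRiemannianManifold.out (I := 𝓡 d)]
  exact (riemannianEDist_le_pathELength (hγ.contMDiffOn.mono (Icc_subset_Icc ha hb)) rfl rfl
    hab).trans (pathELength_mono ha hb)

theorem IsTangentCurve.dist_le [IsRiemannianManifold (𝓡 d) M] (hγ : IsTangentCurve E x y γ)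
    (hfin : pathELength (𝓡 d) γ 0 1 ≠ ⊤) {a b : ℝ} (ha : 0 ≤ a) (hab : a ≤ b) (hb : b ≤ 1) :
    dist (γ a) (γ b) ≤ (pathELength (𝓡 d) γ 0 1).toReal := by
  rw [dist_edist]
  exact ENNReal.toReal_mono hfin (hγ.edist_le ha hab hb)

/-- The speed of a `C¹` curve in a continuous metric is continuous, hence bounded on the compact
interval. -/
theorem IsTangentCurve.pathELength_ne_top [IsManifold (𝓡 d) 1 M]
    [IsContinuousRiemannianBundle (EuclideanSpace ℝ (Fin d))
      (fun x : M ↦ TangentSpace (𝓡 d) x)] (hγ : IsTangentCurve E x y γ) :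
    pathELength (𝓡 d) γ 0 1 ≠ ⊤ := by
  rw [pathELength_eq_lintegral_mfderivWithin_Icc]
  have hu : UniqueMDiffOn 𝓘(ℝ, ℝ) (Icc (0 : ℝ) 1) :=
    (uniqueDiffOn_Icc zero_lt_one).uniqueMDiffOn
  have h1 := hγ.contMDiffOn.continuousOn_tangentMapWithin le_rfl hu
  have hσ : Continuous fun t : ℝ ↦ (⟨t, (1 : ℝ)⟩ : TangentBundle 𝓘(ℝ, ℝ) ℝ) := by
    rw [(tangentBundleModelSpaceHomeomorph 𝓘(ℝ, ℝ)).isInducing.continuous_iff]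
    exact continuous_id.prodMk continuous_const
  have h2 : ContinuousOn (fun t : ℝ ↦ (⟨γ t, mfderivWithin 𝓘(ℝ, ℝ) (𝓡 d) γ (Icc 0 1) t (1 : ℝ)⟩ :
      TangentBundle (𝓡 d) M)) (Icc 0 1) :=
    h1.comp hσ.continuousOn fun t ht ↦ ht
  have h3 : ContinuousOn (fun t : ℝ ↦ ‖mfderivWithin 𝓘(ℝ, ℝ) (𝓡 d) γ (Icc 0 1) t (1 : ℝ)‖)
      (Icc 0 1) := by
    have := (h2.inner_bundle h2).sqrt
    simpa only [← norm_eq_sqrt_real_inner] using this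
  obtain ⟨c, hc⟩ := (isCompact_Icc.image_of_continuousOn h3).bddAbove
  refine ne_top_of_le_ne_top ?_ (MeasureTheory.setLIntegral_mono' (g := fun _ ↦ ENNReal.ofReal c)
    measurableSet_Icc fun t ht ↦ ?_)
  · simp
  · rw [← ofReal_norm]
    exact ENNReal.ofReal_le_ofReal (hc (mem_image_of_mem _ ht))

/-- The length of the image curve bounds the distance from either endpoint to any point of the
curve, and one step contracts it by at least the largest value of `ν` on the curve. -/
theorem IsTangentCurve.isShrinking [IsRiemannianManifold (𝓡 d) M] (hγ : IsTangentCurve E x y γ)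
    (hg : ∀ x, ∀ v ∈ E x, mfderiv (𝓡 d) (𝓡 d) g x v ∈ E (g x)) {ν : M → ℝ} (hν : Continuous ν)
    (hν0 : ∀ x, 0 ≤ ν x)
    (hE : ∀ x, ∀ v ∈ E x, ‖mfderiv (𝓡 d) (𝓡 d) g x v‖ ≤ ν x * ‖v‖)
    (hfin : pathELength (𝓡 d) γ 0 1 ≠ ⊤) :
    IsShrinking g.toEquiv ν x y fun n ↦
      (pathELength (𝓡 d) (((g.toEquiv : Equiv.Perm M) ^ n) ∘ γ) 0 1).toReal := by
  set Γ : ℕ → ℝ → M := fun n ↦ ((g.toEquiv : Equiv.Perm M) ^ n) ∘ γ with hΓ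
  have hΓt (n : ℕ) := hγ.iterate hg n
  have hstep (n : ℕ) : ∃ t ∈ Icc (0 : ℝ) 1, pathELength (𝓡 d) (Γ (n + 1)) 0 1 ≤
      ENNReal.ofReal (ν (Γ n t)) * pathELength (𝓡 d) (Γ n) 0 1 := by
    -- The intermediate point `z` of `IsShrinking` is where `ν` is maximal on the current image
    -- curve.
    obtain ⟨t, ht, hmax⟩ := isCompact_Icc.exists_isMaxOn (nonempty_Icc.2 zero_le_one)
      (hν.comp_continuousOn (hΓt n).contMDiffOn.continuousOn)
    refine ⟨t, ht, ?_⟩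
    have e : Γ (n + 1) = g ∘ Γ n := by
      simp only [hΓ, pow_succ']
      rfl
    rw [e]
    exact (hΓt n).pathELength_comp_le fun u hu v hv ↦
      (hE _ v hv).trans (mul_le_mul_of_nonneg_right (hmax hu) (norm_nonneg _))
  have hΓfin (n : ℕ) : pathELength (𝓡 d) (Γ n) 0 1 ≠ ⊤ := by
    induction n with
    | zero => exact hfin
    | succ n ih =>
      obtain ⟨t, -, h⟩ := hstep n
      exact ne_top_of_le_ne_top (ENNReal.mul_ne_top ENNReal.ofReal_ne_top ih) h
  refine ⟨fun n ↦ ?_, fun n ↦ ?_⟩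
  · have := (hΓt n).dist_le (hΓfin n) le_rfl zero_le_one le_rfl
    rwa [(hΓt n).source, (hΓt n).target] at this
  · obtain ⟨t, ht, h⟩ := hstep n
    refine ⟨Γ n t, ?_, ?_, ?_⟩
    · have := (hΓt n).dist_le (hΓfin n) le_rfl ht.1 ht.2
      rwa [(hΓt n).source] at this
    · have := (hΓt n).dist_le (hΓfin n) ht.1 ht.2 le_rfl
      rwa [(hΓt n).target, dist_comm] at this
    · have := ENNReal.toReal_mono (ENNReal.mul_ne_top ENNReal.ofReal_ne_top (hΓfin n)) h
      rwa [ENNReal.toReal_mul, ENNReal.toReal_ofReal (hν0 _)] at this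

end Curves

/-! ### Contraction of the invariant bundles -/

section Splitting

variable {d : ℕ} {M : Type*} [MetricSpace M] [ChartedSpace (EuclideanSpace ℝ (Fin d)) M]

/-- The chain rule for f⁻¹ ∘ f, read in the model space because the two base points agree only
propositionally. -/
theorem mfderiv_symm_mfderiv (f : M ≃ₘ^1⟮𝓡 d, 𝓡 d⟯ M) (z : M) (u : TangentSpace (𝓡 d) z) :
    (mfderiv (𝓡 d) (𝓡 d) f.symm (f z) (mfderiv (𝓡 d) (𝓡 d) f z u) : EuclideanSpace ℝ (Fin d)) =
      u := by
  have key : ∀ F : M → M, F = id →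
      (mfderiv (𝓡 d) (𝓡 d) F z u : EuclideanSpace ℝ (Fin d)) = u := by
    rintro _ rfl
    rw [mfderiv_id]
    rfl
  have h := key (f.symm ∘ f) (funext f.symm_apply_apply)
  rwa [mfderiv_comp z (f.symm.contMDiff.mdifferentiable one_ne_zero _)
      (f.contMDiff.mdifferentiable one_ne_zero _)] at h

variable [RiemannianBundle (fun x : M ↦ TangentSpace (𝓡 d) x)] {f : M ≃ₘ^1⟮𝓡 d, 𝓡 d⟯ M}
  (P : PartiallyHyperbolic f)

namespace PartiallyHyperbolic

theorem mfderiv_mem_Es (x : M) (v : TangentSpace (𝓡 d) x) (hv : v ∈ P.Es x) :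
    mfderiv (𝓡 d) (𝓡 d) f x v ∈ P.Es (f x) := by
  rw [← P.map_Es x]
  exact Submodule.mem_map_of_mem hv

theorem norm_mfderiv_le_of_mem_Es (x : M) (v : TangentSpace (𝓡 d) x) (hv : v ∈ P.Es x) :
    ‖mfderiv (𝓡 d) (𝓡 d) f x v‖ ≤ P.nu x * ‖v‖ := by
  rcases eq_or_ne v 0 with rfl | h0
  · simp
  · have h := P.stable_lt x (‖v‖⁻¹ • v) ((P.Es x).smul_mem _ hv) (norm_smul_inv_norm h0)
    rw [map_smul, norm_smul, norm_inv, norm_norm, inv_mul_lt_iff₀ (norm_pos_iff.2 h0),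
      mul_comm] at h
    exact h.le

theorem norm_le_of_mem_Eu (x : M) (v : TangentSpace (𝓡 d) x) (hv : v ∈ P.Eu x) :
    ‖v‖ ≤ P.nuHat x * ‖mfderiv (𝓡 d) (𝓡 d) f x v‖ := by
  rcases eq_or_ne v 0 with rfl | h0
  · simp
  · have h := P.lt_unstable x (‖v‖⁻¹ • v) ((P.Eu x).smul_mem _ hv) (norm_smul_inv_norm h0)
    rw [map_smul, norm_smul, norm_inv, norm_norm, inv_mul_eq_div, lt_div_iff₀ (norm_pos_iff.2 h0),
      inv_mul_lt_iff₀ (P.nuHat_pos x)] at h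
    exact h.le

theorem mfderiv_symm_Eu (x : M) (v : TangentSpace (𝓡 d) x) (hv : v ∈ P.Eu x) :
    mfderiv (𝓡 d) (𝓡 d) f.symm x v ∈ P.Eu (f.symm x) ∧
      ‖mfderiv (𝓡 d) (𝓡 d) f.symm x v‖ ≤ P.nuHat (f.symm x) * ‖v‖ := by
  obtain ⟨z, rfl⟩ : ∃ z, f z = x := f.surjective x
  rw [← P.map_Eu z] at hv
  obtain ⟨u, hu, rfl⟩ := hv
  -- Generalizing the base point allows transport along `f.symm (f z) = z`.
  have key : ∀ (z' : M) (w : TangentSpace (𝓡 d) z'), z' = z →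
      (w : EuclideanSpace ℝ (Fin d)) = u →
      w ∈ P.Eu z' ∧ ‖w‖ ≤ P.nuHat z' * ‖mfderiv (𝓡 d) (𝓡 d) f z u‖ := by
    rintro _ w rfl h
    obtain rfl : w = u := h
    exact ⟨hu, P.norm_le_of_mem_Eu _ _ hu⟩
  exact key _ _ (f.symm_apply_apply z) (mfderiv_symm_mfderiv f z u)

end PartiallyHyperbolic

end Splitting

/-! ### Holonomy identities in the limit -/

section LimitHolonomy

theorem IsShrinking.iterate {M : Type*} [PseudoMetricSpace M] {f : Equiv.Perm M} {ν : M → ℝ} {x y : M} {ℓ : ℕ → ℝ} (h : IsShrinking f ν x y ℓ) (n : ℕ) :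
    IsShrinking f ν ((f ^ n) x) ((f ^ n) y) fun m ↦ ℓ (m + n) where
  dist_le m := by
    rw [← Equiv.Perm.mul_apply, ← Equiv.Perm.mul_apply, ← pow_add]
    exact h.dist_le _
  step m := by
    rw [← Equiv.Perm.mul_apply, ← Equiv.Perm.mul_apply, ← pow_add, Nat.add_right_comm]
    exact h.step _

variable {M R : Type*} [NormedRing R] {f : Equiv.Perm M} {A : M → Rˣ}

theorem limitHolonomy_self (x : M) : limitHolonomy f A x x = 1 := by
  refine Tendsto.limUnder_eq ?_
  simp only [transition_self]
  exact tendsto_const_nhds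

theorem limitHolonomy_comp {x y z : M}
    (hxy : Tendsto (fun n ↦ transition f A n x y) atTop (𝓝 (limitHolonomy f A x y)))
    (hyz : Tendsto (fun n ↦ transition f A n y z) atTop (𝓝 (limitHolonomy f A y z))) :
    limitHolonomy f A y z * limitHolonomy f A x y = limitHolonomy f A x z :=
  ((hyz.mul hxy).congr fun n ↦ transition_comp f A n x y z).limUnder_eq.symm

/-- The transition at time `m + n` is the one at time `m` between the `n`-th iterates, conjugated by
fixed factors; let `m` tend to infinity. -/
theorem limitHolonomy_equivariant {x y : M} (n : ℕ)
    (h : Tendsto (fun m ↦ transition f A m ((f ^ n) x) ((f ^ n) y)) atTop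
      (𝓝 (limitHolonomy f A ((f ^ n) x) ((f ^ n) y)))) :
    limitHolonomy f A x y = (forward f A y n)⁻¹ *
      limitHolonomy f A ((f ^ n) x) ((f ^ n) y) * forward f A x n := by
  refine Tendsto.limUnder_eq ((tendsto_add_atTop_iff_nat n).1 ?_)
  simp only [transition_add]
  exact (tendsto_const_nhds.mul h).mul tendsto_const_nhds

end LimitHolonomy

/-! ### From Hölder to relative Hölder conditions -/

section Holder

variable {M 𝕜 V : Type*} [PseudoMetricSpace M] [RCLike 𝕜] [NormedAddCommGroup V] [NormedSpace 𝕜 V]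
  {β : ℝ} {A : M → (V →L[𝕜] V)ˣ}

theorem IsHolder.exists_norm_sub_le (hA : IsHolder β A) :
    ∃ K : ℝ, 0 ≤ K ∧ ∀ x y, ‖(A x : V →L[𝕜] V) - (A y : V →L[𝕜] V)‖ ≤ K * dist x y ^ β := by
  obtain ⟨K, hK⟩ := hA
  refine ⟨max K 0, le_max_right _ _, fun x y ↦ ?_⟩
  refine (le_add_of_nonneg_right (norm_nonneg _)).trans ((hK x y).trans ?_)
  exact mul_le_mul_of_nonneg_right (le_max_left _ _) (Real.rpow_nonneg dist_nonneg β)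

variable [CompleteSpace V]

theorem IsHolder.continuous (hβ : 0 < β) (hA : IsHolder β A) : Continuous A := by
  obtain ⟨K, -, hK⟩ := hA.exists_norm_sub_le
  rw [Units.isOpenEmbedding_val.isInducing.continuous_iff, continuous_iff_continuousAt]
  intro x
  refine tendsto_iff_dist_tendsto_zero.2 (squeeze_zero (fun _ ↦ dist_nonneg)
    (fun y ↦ (dist_eq_norm _ _).trans_le (hK y x)) ?_)
  have h : Continuous fun y ↦ K * dist y x ^ β :=
    continuous_const.mul ((continuous_id.dist continuous_const).rpow_const fun _ ↦ Or.inr hβ.le)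
  simpa [Real.zero_rpow hβ.ne'] using h.tendsto x

variable [CompactSpace M]

theorem IsHolder.exists_norm_inv_le (hβ : 0 < β) (hA : IsHolder β A) :
    ∃ b : ℝ, 0 ≤ b ∧ ∀ x, ‖(((A x)⁻¹ : (V →L[𝕜] V)ˣ) : V →L[𝕜] V)‖ ≤ b := by
  obtain ⟨b, hb⟩ := exists_forall_le
    (Units.continuous_val.comp (hA.continuous hβ).inv).norm
  exact ⟨max b 0, le_max_right _ _, fun x ↦ (hb x).trans (le_max_left _ _)⟩

/-- A(y)⁻¹A(x) − Id = A(y)⁻¹(A(x) − A(y)), and compactness bounds the inverse. -/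
theorem IsHolder.isRelHolder (hβ : 0 < β) (hA : IsHolder β A) (f : Equiv.Perm M) :
    ∃ K, 0 ≤ K ∧ IsRelHolder f K β A := by
  obtain ⟨K, hK0, hK⟩ := hA.exists_norm_sub_le
  obtain ⟨b, hb0, hb⟩ := hA.exists_norm_inv_le hβ
  refine ⟨b * K, by positivity, fun x y ↦ ?_⟩
  have e : (((A y)⁻¹ * A x : (V →L[𝕜] V)ˣ) : V →L[𝕜] V) - 1 =
      (((A y)⁻¹ : (V →L[𝕜] V)ˣ) : V →L[𝕜] V) * ((A x : V →L[𝕜] V) - (A y : V →L[𝕜] V)) := by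
    rw [mul_sub, Units.inv_mul, Units.val_mul]
  rw [e, mul_assoc]
  refine (norm_mul_le _ _).trans (mul_le_mul (hb y) ((hK x y).trans ?_) (norm_nonneg _) hb0)
  exact mul_le_mul_of_nonneg_left
    (Real.rpow_le_rpow dist_nonneg (le_max_left _ _) hβ.le) hK0

/-- The reversed generator evaluates `A` at the f⁻¹-images, so the second entry of the maximum in
`IsRelHolder` is the relevant one; no Lipschitz bound for f⁻¹ is needed. -/
theorem IsHolder.isRelHolder_reverse (hβ : 0 < β) (hA : IsHolder β A) (f : Equiv.Perm M) :
    ∃ K, 0 ≤ K ∧ IsRelHolder f⁻¹ K β (reverse f A) := by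
  obtain ⟨K, hK0, hK⟩ := hA.exists_norm_sub_le
  obtain ⟨b, hb0, hb⟩ := hA.exists_norm_inv_le hβ
  refine ⟨K * b, by positivity, fun x y ↦ ?_⟩
  have e : (((reverse f A y)⁻¹ * reverse f A x : (V →L[𝕜] V)ˣ) : V →L[𝕜] V) - 1 =
      ((A (f⁻¹ y) : V →L[𝕜] V) - (A (f⁻¹ x) : V →L[𝕜] V)) *
        (((A (f⁻¹ x))⁻¹ : (V →L[𝕜] V)ˣ) : V →L[𝕜] V) := by
    rw [sub_mul, Units.mul_inv, reverse, reverse, inv_inv, Units.val_mul]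
  rw [e, mul_right_comm]
  refine (norm_mul_le _ _).trans (mul_le_mul ((hK _ _).trans ?_) (hb _) (norm_nonneg _)
    (mul_nonneg hK0 (Real.rpow_nonneg (le_max_of_le_left dist_nonneg) β)))
  rw [dist_comm]
  exact mul_le_mul_of_nonneg_left
    (Real.rpow_le_rpow dist_nonneg (le_max_right _ _) hβ.le) hK0

end Holder

/-! ### Standard holonomies and their intertwining -/

section Holonomy

variable {d : ℕ} {M : Type*} [MetricSpace M] [ChartedSpace (EuclideanSpace ℝ (Fin d)) M]
  {f : M ≃ₘ^1⟮𝓡 d, 𝓡 d⟯ M}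

theorem toEquiv_zpow_neg (n : ℕ) :
    (f.toEquiv : Equiv.Perm M) ^ (-(n : ℤ)) = (f.toEquiv : Equiv.Perm M)⁻¹ ^ n := by
  rw [zpow_neg, zpow_natCast, inv_pow]

variable [RiemannianBundle (fun x : M ↦ TangentSpace (𝓡 d) x)] (P : PartiallyHyperbolic f)

/-- The rate of contraction of the unstable bundle under `f⁻¹`. -/
noncomputable def PartiallyHyperbolic.unstableRate (x : M) : ℝ := P.nuHat (f.symm x)

theorem PartiallyHyperbolic.continuous_unstableRate : Continuous P.unstableRate :=
  P.continuous_nuHat.comp f.symm.continuous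

theorem exists_isTangentCurve_of_leafEDist_lt
    {E : ∀ x : M, Submodule ℝ (TangentSpace (𝓡 d) x)} {x y : M} {r : ℝ}
    (h : leafEDist E x y < ENNReal.ofReal r) :
    ∃ γ, IsTangentCurve E x y γ ∧ pathELength (𝓡 d) γ 0 1 ≠ ⊤ ∧
      (pathELength (𝓡 d) γ 0 1).toReal ≤ r := by
  simp only [leafEDist, iInf_lt_iff] at h
  obtain ⟨γ, hγ, h⟩ := h
  exact ⟨γ, hγ, h.ne_top, (ENNReal.toReal_lt_of_lt_ofReal h).le⟩

variable {𝕜 V : Type*} [RCLike 𝕜] [NormedAddCommGroup V] [NormedSpace 𝕜 V]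
  [CompleteSpace V] {β : ℝ} {A B C : M → (V →L[𝕜] V)ˣ}

variable {P} in
theorem IsFiberBunched.isBunched (hβ : 0 < β) (hA : IsFiberBunched P β A) :
    IsBunched P.nu β A :=
  ⟨hβ, hA.1.continuous hβ, P.continuous_nu, P.nu_pos, P.nu_lt_one, fun x ↦ (hA.2 x).1⟩

variable {P} in
theorem IsFiberBunched.isBunched_reverse (hβ : 0 < β)
    (hA : IsFiberBunched P β A) : IsBunched P.unstableRate β (reverse f.toEquiv A) where
  exponent_pos := hβ
  continuous := ((hA.1.continuous hβ).comp f.symm.continuous).inv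
  continuous_rate := P.continuous_unstableRate
  rate_pos _ := P.nuHat_pos _
  rate_lt_one _ := P.nuHat_lt_one _
  lt_one x := by
    rw [reverse, inv_inv, mul_comm ‖_‖ ‖_‖]
    exact (hA.2 _).2

variable [IsRiemannianManifold (𝓡 d) M]

theorem IsTangentCurve.isShrinking_stable {x y : M} {γ : ℝ → M} (hγ : IsTangentCurve P.Es x y γ)
    (hfin : pathELength (𝓡 d) γ 0 1 ≠ ⊤) :
    ∃ ℓ, IsShrinking f.toEquiv P.nu x y ℓ ∧ ℓ 0 = (pathELength (𝓡 d) γ 0 1).toReal :=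
  ⟨_, hγ.isShrinking P.mfderiv_mem_Es P.continuous_nu (fun x ↦ (P.nu_pos x).le)
    P.norm_mfderiv_le_of_mem_Es hfin, rfl⟩

theorem IsTangentCurve.isShrinking_unstable {x y : M} {γ : ℝ → M}
    (hγ : IsTangentCurve P.Eu x y γ) (hfin : pathELength (𝓡 d) γ 0 1 ≠ ⊤) :
    ∃ ℓ, IsShrinking (f.toEquiv : Equiv.Perm M)⁻¹ P.unstableRate x y ℓ ∧
      ℓ 0 = (pathELength (𝓡 d) γ 0 1).toReal :=
  ⟨_, hγ.isShrinking (g := f.symm) (fun x v hv ↦ (P.mfderiv_symm_Eu x v hv).1)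
    P.continuous_unstableRate (fun _ ↦ (P.nuHat_pos _).le)
    (fun x v hv ↦ (P.mfderiv_symm_Eu x v hv).2) hfin, rfl⟩

variable [IsManifold (𝓡 d) 1 M]
  [IsContinuousRiemannianBundle (EuclideanSpace ℝ (Fin d)) (fun x : M ↦ TangentSpace (𝓡 d) x)]

theorem exists_isShrinking_of_mem_Ws {x y : M} (h : y ∈ P.Ws x) :
    ∃ ℓ, IsShrinking f.toEquiv P.nu x y ℓ := by
  obtain ⟨γ, hγ⟩ := h
  obtain ⟨ℓ, hℓ, -⟩ := hγ.isShrinking_stable P hγ.pathELength_ne_top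
  exact ⟨ℓ, hℓ⟩

theorem exists_isShrinking_of_mem_Wu {x y : M} (h : y ∈ P.Wu x) :
    ∃ ℓ, IsShrinking (f.toEquiv : Equiv.Perm M)⁻¹ P.unstableRate x y ℓ := by
  obtain ⟨γ, hγ⟩ := h
  obtain ⟨ℓ, hℓ, -⟩ := hγ.isShrinking_unstable P hγ.pathELength_ne_top
  exact ⟨ℓ, hℓ⟩

variable [CompactSpace M]

variable {P}

theorem IsFiberBunched.isStandardStableHolonomy (hβ : 0 < β) (hA : IsFiberBunched P β A) :
    IsStandardStableHolonomy P A (limitHolonomy f.toEquiv A) := by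
  obtain ⟨K, hK, hAK⟩ := hA.1.isRelHolder hβ f.toEquiv
  have hb := hA.isBunched hβ
  have hlim : ∀ x, ∀ y ∈ P.Ws x, Tendsto (fun n ↦ transition f.toEquiv A n x y) atTop
      (𝓝 (limitHolonomy f.toEquiv A x y)) := fun x y hy ↦
    (exists_isShrinking_of_mem_Ws P hy).elim fun _ h ↦ hb.tendsto_transition hAK hK h
  refine ⟨fun r hr ↦ ?_, limitHolonomy_self, fun x y hy z hz ↦ ?_, fun x y hy n ↦ ?_, hlim⟩
  -- A curve nearly realizing the leaf distance starts with `ℓ 0 ≤ r`, so the uniform bound applies.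
  · refine hb.continuousOn_limitHolonomy hAK hK f.continuous (r := r) fun p hp ↦ ?_
    obtain ⟨γ, hγ, hfin, hle⟩ := exists_isTangentCurve_of_leafEDist_lt hp
    obtain ⟨ℓ, hℓ, h0⟩ := hγ.isShrinking_stable P hfin
    exact ⟨ℓ, hℓ, h0.trans_le hle⟩
  · exact limitHolonomy_comp (hlim x y hy) (hlim y z hz)
  · obtain ⟨ℓ, h⟩ := exists_isShrinking_of_mem_Ws P hy
    exact limitHolonomy_equivariant n (hb.tendsto_transition hAK hK (h.iterate n))

theorem IsFiberBunched.isStandardUnstableHolonomy (hβ : 0 < β) (hA : IsFiberBunched P β A) :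
    IsStandardUnstableHolonomy P A
      (limitHolonomy (f.toEquiv : Equiv.Perm M)⁻¹ (reverse f.toEquiv A)) := by
  obtain ⟨K, hK, hAK⟩ := hA.1.isRelHolder_reverse hβ f.toEquiv
  have hb := hA.isBunched_reverse hβ
  have hlim : ∀ x, ∀ y ∈ P.Wu x,
      Tendsto (fun n ↦ transition (f.toEquiv : Equiv.Perm M)⁻¹ (reverse f.toEquiv A) n x y) atTop
        (𝓝 (limitHolonomy (f.toEquiv : Equiv.Perm M)⁻¹ (reverse f.toEquiv A) x y)) :=
    fun x y hy ↦
      (exists_isShrinking_of_mem_Wu P hy).elim fun _ h ↦ hb.tendsto_transition hAK hK h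
  refine ⟨fun r hr ↦ ?_, limitHolonomy_self, fun x y hy z hz ↦ ?_, fun x y hy n ↦ ?_,
    fun x y hy ↦ ?_⟩
  · refine hb.continuousOn_limitHolonomy hAK hK f.symm.continuous (r := r) fun p hp ↦ ?_
    obtain ⟨γ, hγ, hfin, hle⟩ := exists_isTangentCurve_of_leafEDist_lt hp
    obtain ⟨ℓ, hℓ, h0⟩ := hγ.isShrinking_unstable P hfin
    exact ⟨ℓ, hℓ, h0.trans_le hle⟩
  · exact limitHolonomy_comp (hlim x y hy) (hlim y z hz)
  · obtain ⟨ℓ, h⟩ := exists_isShrinking_of_mem_Wu P hy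
    rw [cocycle_neg_natCast, cocycle_neg_natCast, toEquiv_zpow_neg]
    exact limitHolonomy_equivariant n (hb.tendsto_transition hAK hK (h.iterate n))
  · simp only [cocycle_neg_natCast]
    exact hlim x y hy

theorem IsStandardStableHolonomy.intertwines (hβ : 0 < β) (hB : IsFiberBunched P β B)
    (hAB : IsConjugacy f.toEquiv A B C) (hC : IsHolder β C) {HA HB : M → M → (V →L[𝕜] V)ˣ}
    (hHA : IsStandardStableHolonomy P A HA) (hHB : IsStandardStableHolonomy P B HB) :
    Intertwines P.Ws C HA HB := by
  intro x y hy
  obtain ⟨K, hK, hCK⟩ := hC.isRelHolder hβ f.toEquiv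
  obtain ⟨ℓ, h⟩ := exists_isShrinking_of_mem_Ws P hy
  exact (hB.isBunched hβ).limit_intertwines hAB hCK hK h (hHA.standard x y hy)
    (hHB.standard x y hy)

theorem IsStandardUnstableHolonomy.intertwines (hβ : 0 < β) (hB : IsFiberBunched P β B)
    (hAB : IsConjugacy f.toEquiv A B C) (hC : IsHolder β C) {HA HB : M → M → (V →L[𝕜] V)ˣ}
    (hHA : IsStandardUnstableHolonomy P A HA) (hHB : IsStandardUnstableHolonomy P B HB) :
    Intertwines P.Wu C HA HB := by
  intro x y hy
  -- Time reversal changes the generators but not `C`, so the unreversed Hölder lemma applies, over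
  -- f⁻¹.
  obtain ⟨K, hK, hCK⟩ := hC.isRelHolder hβ (f.toEquiv : Equiv.Perm M)⁻¹
  obtain ⟨ℓ, h⟩ := exists_isShrinking_of_mem_Wu P hy
  have h1 := hHA.standard x y hy
  have h2 := hHB.standard x y hy
  simp only [cocycle_neg_natCast] at h1 h2
  exact (hB.isBunched_reverse hβ).limit_intertwines hAB.reverse hCK hK h h1 h2

end Holonomy

end PHCocycle

theorem proposition4p6 {d : ℕ} {M : Type*} [MetricSpace M]
    [ChartedSpace (EuclideanSpace ℝ (Fin d)) M] [IsManifold (𝓡 d) ∞ M]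
    [RiemannianBundle (fun x : M ↦ TangentSpace (𝓡 d) x)]
    [IsContMDiffRiemannianBundle (𝓡 d) ∞ (EuclideanSpace ℝ (Fin d))
      (fun x : M ↦ TangentSpace (𝓡 d) x)]
    [IsRiemannianManifold (𝓡 d) M] [CompactSpace M] [ConnectedSpace M]
    {𝕜 V : Type*} [RCLike 𝕜] [NormedAddCommGroup V] [NormedSpace 𝕜 V] [CompleteSpace V]
    (f : M ≃ₘ^1⟮𝓡 d, 𝓡 d⟯ M) (P : PHCocycle.PartiallyHyperbolic f) (β : ℝ) (hβ : 0 < β)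
    (A B : M → (V →L[𝕜] V)ˣ)
    (hA : PHCocycle.IsFiberBunched P β A) (hB : PHCocycle.IsFiberBunched P β B) :
    ((∃ HA, PHCocycle.IsStandardStableHolonomy P A HA) ∧
      (∃ HA, PHCocycle.IsStandardUnstableHolonomy P A HA) ∧
      (∃ HB, PHCocycle.IsStandardStableHolonomy P B HB) ∧
      (∃ HB, PHCocycle.IsStandardUnstableHolonomy P B HB)) ∧
    ∀ C : M → (V →L[𝕜] V)ˣ, PHCocycle.IsConjugacy f.toEquiv A B C → PHCocycle.IsHolder β C →
      (∀ HA HB, PHCocycle.IsStandardStableHolonomy P A HA →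
        PHCocycle.IsStandardStableHolonomy P B HB →
        PHCocycle.Intertwines P.Ws C HA HB) ∧
      (∀ HA HB, PHCocycle.IsStandardUnstableHolonomy P A HA →
        PHCocycle.IsStandardUnstableHolonomy P B HB →
        PHCocycle.Intertwines P.Wu C HA HB) := by
  have : IsManifold (𝓡 d) 1 M := IsManifold.of_le (n := ∞) (by simp)
  have : IsContinuousRiemannianBundle (EuclideanSpace ℝ (Fin d))
      (fun x : M ↦ TangentSpace (𝓡 d) x) := by
    obtain ⟨g, hg, h⟩ := IsContMDiffRiemannianBundle.exists_contMDiff (IB := 𝓡 d) (n := ∞)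
      (F := EuclideanSpace ℝ (Fin d)) (E := fun x : M ↦ TangentSpace (𝓡 d) x)
    exact ⟨g, hg.continuous, h⟩
  exact ⟨⟨⟨_, hA.isStandardStableHolonomy hβ⟩, ⟨_, hA.isStandardUnstableHolonomy hβ⟩,
    ⟨_, hB.isStandardStableHolonomy hβ⟩, ⟨_, hB.isStandardUnstableHolonomy hβ⟩⟩,
    fun C hAB hC ↦ ⟨fun HA HB hHA hHB ↦ hHA.intertwines hβ hB hAB hC hHB,
      fun HA HB hHA hHB ↦ hHA.intertwines hβ hB hAB hC hHB⟩⟩
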